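/- Let $n\ge 1$ balls be given, each coloured with one of two colours in an unknown way. A query is a set of three of the balls; the answer to a query is a majority ball of it, that is, a ball of the triple whose colour is shared by at least one other ball of the triple (if several balls of the triple qualify, any one of them may be given as the answer). A non-minority ball is a ball whose colour occurs at least $n/2$ times among the $n$ balls. Let $A_3(n)$ be the minimum number of queries that suffice in the worst case, over all colourings and all admissible answers, to determine a non-minority ball by adaptive search, that is, when each query may depend on the answers to the earlier ones. Then a non-minority ball can always be determined, and $A_3(n)=O(n)$: there is a constant $C>0$ such that $A_3(n)\le Cn$ for all $n\ge 1$. -/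

import Mathlib

namespace BallSearch

/-- `b` is a majority ball of `A` under the colouring `c`: it lies in `A`, and more than `|A| / 2`
balls of `A` have the colour of `b`. -/
def IsMajorityBall {n : ℕ} (c : Fin n → Bool) (A : Finset (Fin n)) (b : Fin n) : Prop :=
  b ∈ A ∧ A.card < 2 * (A.filter (fun x => c x = c b)).card

/-- `b` is a non-minority ball of `A` under the colouring `c`: it lies in `A`, and at least
`|A| / 2` balls of `A` have the colour of `b`. -/
def IsNonMinorityBall {n : ℕ} (c : Fin n → Bool) (A : Finset (Fin n)) (b : Fin n) : Prop :=
  b ∈ A ∧ A.card ≤ 2 * (A.filter (fun x => c x = c b)).card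

/-- The answers that are allowed for the query `Q` under the colouring `c`: any majority ball of
`Q`, or `none` (meaning that `Q` has no majority ball) when there is none. For `|Q|` odd and two
colours a majority ball always exists, so `none` is then never allowed. -/
def IsValidAnswer {n : ℕ} (c : Fin n → Bool) (Q : Finset (Fin n)) : Option (Fin n) → Prop
  | some b => IsMajorityBall c Q b
  | none => ∀ b, ¬ IsMajorityBall c Q b

/-- An adaptive search strategy on `n` balls with queries of size `q`: either stop and output a
ball, or query a set of `q` balls and continue in a way that depends on the answer. -/
inductive Strategy (q n : ℕ) : Type
  | output (b : Fin n) : Strategy q n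
  | query (Q : Finset (Fin n)) (hQ : Q.card = q) (next : Option (Fin n) → Strategy q n) :
      Strategy q n

/-- Under the colouring `c`, whichever allowed answers are given, the strategy stops after at most
`k` queries and outputs a non-minority ball of the set of all balls. -/
def Strategy.FindsWithin {q n : ℕ} (c : Fin n → Bool) : Strategy q n → ℕ → Prop
  | .output b, _ => IsNonMinorityBall c Finset.univ b
  | .query _ _ _, 0 => False
  | .query Q _ next, k + 1 => ∀ a, IsValidAnswer c Q a → (next a).FindsWithin c k

/-- Some adaptive strategy with queries of size `q` finds, for every colouring of `n` balls with
two colours, a non-minority ball with at most `k` queries in the worst case. -/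
def AdaptivelySolvable (q n k : ℕ) : Prop :=
  ∃ s : Strategy q n, ∀ c : Fin n → Bool, s.FindsWithin c k

/-- `A_q(n)`: the minimum number of queries of size `q` needed in the worst case to find a
non-minority ball among `n` balls of two colours by adaptive search (`⊤` if it is impossible). -/
noncomputable def A (q n : ℕ) : ℕ∞ :=
  ⨅ (k : ℕ) (_ : AdaptivelySolvable q n k), (k : ℕ∞)

end BallSearch

/-!
A searcher's knowledge is the set `K` of colourings that agree with all answers so far, and
`Learnable G K k` says that at most `k` queries lead from `K` to knowledge with the property `G`.
Exchanging the colours changes neither answers nor non-minority balls, so some fixed ball `b` may be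
taken to be `true`.

*Two anchors.* If `b` answers the query `{b, p, q}`, then `p` or `q` is `true`, and dropping both
does not hurt a majority of `false` balls; if `q` answers, then `p` true forces `q` true, and keeping
only `p` does not hurt it either. A knock-out tournament of this kind leaves, after at most `n`
queries, a ball `x` that is `false` if `b` is a minority ball (`learnable_candidate`). So if `x` has
the colour of `b`, then `b` is non-minority, and the queries `{b, x, q}` sort out a set `P` of
"middle" balls that also have this colour then, while all other balls are known if `b` and `x`
differ. Any output from `P ∪ {b, x}` is right if `b` and `x` agree, so from now on `b` is `true` and
`x` is `false`.

*Comparison.* Under this hypothesis the queries `{b, p, q}` and `{x, p, q}` show `p ≤ q` or `q ≤ p`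
or `p ≠ q`, in the order `false ≤ true` (`learnable_compare`). What is wanted is a ball of `P` of
prescribed rank: if it is `false`, so are the balls known to lie below it, and if it is `true`, so
are those above. The algorithm of medians of medians of blocks of five finds one, provided that the
third outcome `m ≠ p` can be dealt with. Comparing a third ball `q` with both `m` and `p` shows that
`q` is constant, equal to `m`, or equal to `p`, unless it reveals the colour of `m`
(`learnable_const_or_decidedBy`). Doing this for all `q ∈ P` either leaves two colourings of `P`, and
then one of `b`, `x`, `m`, `p` is non-minority, or reveals the colour of `m`. The latter is worth its
linear cost when `m` is a pivot, since it reveals one side of the pivot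
(`learnable_selected_step`). The opposite pairs met while forming the blocks are resolved all
together at linear cost (`learnable_forall_const_or_decided`). This gives the linear bound
`learnable_selected`, with the usual recursion to sets of about `1/5` and `7/10` of the size.
-/

namespace BallSearch

/-! ### Knowledge and queries -/

/-- `Learnable G K k`: a searcher who knows that the colouring lies in `K` can, with at most `k`
further queries of size three, always reach a state of knowledge `K'` with `G K'`. -/
inductive Learnable {n : ℕ} (G : Set (Fin n → Bool) → Prop) : Set (Fin n → Bool) → ℕ → Prop
  | done {K : Set (Fin n → Bool)} {k : ℕ} (h : G K) : Learnable G K k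
  | ask {K : Set (Fin n → Bool)} {k : ℕ} (Q : Finset (Fin n)) (hQ : Q.card = 3)
      (h : ∀ a, Learnable G (K ∩ {c | IsValidAnswer c Q a}) k) : Learnable G K (k + 1)

section Learnable

variable {n : ℕ} {G G' H : Set (Fin n → Bool) → Prop} {K : Set (Fin n → Bool)} {k k' : ℕ}

theorem Learnable.mono_cost (h : Learnable G K k) : ∀ {k'}, k ≤ k' → Learnable G K k' := by
  induction h with
  | done h => intro k' _; exact .done h
  | ask Q hQ _ ih =>
    intro k' hk
    obtain ⟨j, rfl⟩ : ∃ j, k' = j + 1 := ⟨k' - 1, by omega⟩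
    exact .ask Q hQ fun a => ih a (by omega)

theorem Learnable.bind (h : Learnable G K k) :
    (∀ K' ⊆ K, G K' → Learnable G' K' k') → Learnable G' K (k + k') := by
  induction h with
  | done h => intro hG; exact (hG _ subset_rfl h).mono_cost (by omega)
  | @ask K k Q hQ _ ih =>
    intro hG
    have : Learnable G' K ((k + k') + 1) :=
      .ask Q hQ fun a => ih a fun K' hK' => hG K' (hK'.trans Set.inter_subset_left)
    exact this.mono_cost (by omega)

theorem Learnable.imp (h : Learnable G K k) (hG : ∀ K' ⊆ K, G K' → G' K') : Learnable G' K k :=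
  h.bind (k' := 0) fun K' hK' hGK' => .done (hG K' hK' hGK')

/-- The queries that serve under a hypothesis `A` can be asked without it: what they teach then
holds for the colourings in `A`. -/
theorem Learnable.of_inter {A : Set (Fin n → Bool)} (h : Learnable G (K ∩ A) k) :
    Learnable (fun L => G (L ∩ A)) K k := by
  generalize hM : K ∩ A = M at h
  induction h generalizing K with
  | done h => subst hM; exact .done h
  | ask Q hQ _ ih =>
    subst hM
    exact .ask Q hQ fun a => ih a (Set.inter_right_comm _ _ _)

/-- Facts about single balls that survive further queries can be learnt ball by ball, unless a
final fact `H` turns up on the way. -/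
theorem Learnable.forall_or {G : Fin n → Set (Fin n → Bool) → Prop} {t : ℕ}
    (hG : ∀ q, Antitone (G q)) (S : Finset (Fin n)) {K : Set (Fin n → Bool)}
    (h : ∀ q ∈ S, ∀ K' ⊆ K, Learnable (fun L => G q L ∨ H L) K' t) :
    Learnable (fun L => (∀ q ∈ S, G q L) ∨ H L) K (t * S.card) := by
  induction S using Finset.induction_on with
  | empty => exact .done (Or.inl (by simp))
  | insert a S ha ih =>
    rw [Finset.card_insert_of_notMem ha, mul_add, mul_one]
    refine (ih fun q hq => h q (Finset.mem_insert_of_mem hq)).bind fun K' hK' h' => ?_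
    rcases h' with h' | h'
    · refine (h a (Finset.mem_insert_self _ _) K' hK').imp fun L hL hG' => ?_
      rcases hG' with hG' | hG'
      · left
        intro q hq
        rcases Finset.mem_insert.1 hq with rfl | hq
        · exact hG'
        · exact hG q hL (h' q hq)
      · exact Or.inr hG'
    · exact .done (Or.inr h')

/-- A query of three balls: the colour of the answer is shared by one of the other two. -/
theorem Learnable.ask_triple {a p q : Fin n} (hap : a ≠ p) (haq : a ≠ q) (hpq : p ≠ q)
    (ha : ∀ K' ⊆ K, (∀ c ∈ K', c p = c a ∨ c q = c a) → Learnable G K' k)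
    (hp : ∀ K' ⊆ K, (∀ c ∈ K', c a = c p ∨ c q = c p) → Learnable G K' k)
    (hq : ∀ K' ⊆ K, (∀ c ∈ K', c a = c q ∨ c p = c q) → Learnable G K' k) :
    Learnable G K (k + 1) := by
  have hcard : ({a, p, q} : Finset (Fin n)).card = 3 := Finset.card_eq_three.2
    ⟨a, p, q, hap, haq, hpq, rfl⟩
  have two : ∀ (c : Fin n → Bool) (r s : Fin n), r ∈ ({a, p, q} : Finset (Fin n)) →
      s ∈ ({a, p, q} : Finset (Fin n)) → s ≠ r → c s = c r →
      IsMajorityBall c {a, p, q} r := by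
    intro c r s hr hs hsr hc
    refine ⟨hr, ?_⟩
    have : ({s, r} : Finset (Fin n)) ⊆ ({a, p, q} : Finset (Fin n)).filter (c · = c r) := by
      intro t ht
      rcases Finset.mem_insert.1 ht with rfl | ht
      · exact Finset.mem_filter.2 ⟨hs, hc⟩
      · rw [Finset.mem_singleton.1 ht]; exact Finset.mem_filter.2 ⟨hr, rfl⟩
    have := Finset.card_le_card this
    rw [Finset.card_pair hsr] at this
    omega
  have one : ∀ (c : Fin n → Bool) (r : Fin n), IsMajorityBall c {a, p, q} r →
      ∃ s ∈ ({a, p, q} : Finset (Fin n)), s ≠ r ∧ c s = c r := by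
    intro c r hr
    have h2 : 1 < (({a, p, q} : Finset (Fin n)).filter (c · = c r)).card := by
      have := hr.2; omega
    obtain ⟨s, hs, hsr⟩ := Finset.exists_mem_ne h2 r
    exact ⟨s, (Finset.mem_filter.1 hs).1, hsr, (Finset.mem_filter.1 hs).2⟩
  refine .ask {a, p, q} hcard fun r => ?_
  rcases r with _ | r
  · refine ha _ Set.inter_subset_left fun c hc => ?_
    by_contra hne
    rw [not_or] at hne
    refine hc.2 q (two c q p (by simp) (by simp) hpq ?_)
    cases h1 : c p <;> cases h2 : c q <;> cases h3 : c a <;> simp_all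
  · by_cases hr : r = a
    · subst hr
      refine ha _ Set.inter_subset_left fun c hc => ?_
      obtain ⟨s, hs, hsr, h⟩ := one c _ hc.2
      simp only [Finset.mem_insert, Finset.mem_singleton] at hs
      rcases hs with rfl | rfl | rfl <;> simp_all
    · by_cases hr' : r = p
      · subst hr'
        refine hp _ Set.inter_subset_left fun c hc => ?_
        obtain ⟨s, hs, hsr, h⟩ := one c _ hc.2
        simp only [Finset.mem_insert, Finset.mem_singleton] at hs
        rcases hs with rfl | rfl | rfl <;> simp_all
      · refine hq _ Set.inter_subset_left fun c hc => ?_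
        obtain ⟨s, hs, hsr, h⟩ := one c _ hc.2
        have := hc.2.1
        simp only [Finset.mem_insert, Finset.mem_singleton] at hs this
        rcases this with rfl | rfl | rfl
        · exact absurd rfl hr
        · exact absurd rfl hr'
        · rcases hs with rfl | rfl | rfl <;> simp_all

end Learnable

/-! ### What is known about two balls -/

section Relations

variable {n : ℕ} {K K' L : Set (Fin n → Bool)} {m p q r : Fin n}

/-- In the order `false ≤ true` of colours, `p` is known to lie below `q`. -/
def Le (K : Set (Fin n → Bool)) (p q : Fin n) : Prop := ∀ c ∈ K, c p = true → c q = true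

/-- `p` and `q` are known to have different colours. -/
def Opp (K : Set (Fin n → Bool)) (p q : Fin n) : Prop := ∀ c ∈ K, c p ≠ c q

/-- The colour of `p` is known. -/
def Const (K : Set (Fin n → Bool)) (p : Fin n) : Prop := ∀ c ∈ K, ∀ c' ∈ K, c p = c' p

/-- Knowing the colour of `m` would be enough to know that of `q`. -/
def DecidedBy (K : Set (Fin n → Bool)) (m q : Fin n) : Prop :=
  ∀ c ∈ K, ∀ c' ∈ K, c m = c' m → c q = c' q

theorem antitone_le (p q : Fin n) : Antitone fun K => Le K p q :=
  fun _ _ hK h c hc => h c (hK hc)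

theorem antitone_opp (p q : Fin n) : Antitone fun K => Opp K p q :=
  fun _ _ hK h c hc => h c (hK hc)

theorem antitone_const (p : Fin n) : Antitone fun K => Const K p :=
  fun _ _ hK h c hc c' hc' => h c (hK hc) c' (hK hc')

theorem antitone_decidedBy (p q : Fin n) : Antitone fun K => DecidedBy K p q :=
  fun _ _ hK h c hc c' hc' => h c (hK hc) c' (hK hc')

theorem Le.trans (h : Le K p q) (h' : Le K q r) : Le K p r := fun c hc hp => h' c hc (h c hc hp)

theorem Le.eq_false {c : Fin n → Bool} (h : Le K p q) (hc : c ∈ K) (hq : c q = false) :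
    c p = false :=
  (Bool.eq_false_or_eq_true (c p)).resolve_left fun hp =>
    Bool.false_ne_true (hq.symm.trans (h c hc hp))

theorem le_refl (p : Fin n) : Le K p p := fun _ _ h => h

theorem Opp.symm (h : Opp K p q) : Opp K q p := fun c hc h' => h c hc h'.symm

theorem Const.decidedBy (h : Const K q) (m : Fin n) : DecidedBy K m q :=
  fun c hc c' hc' _ => h c hc c' hc'

theorem DecidedBy.const (h : DecidedBy K m q) (hm : Const K m) : Const K q :=
  fun c hc c' hc' => h c hc c' hc' (hm c hc c' hc')

theorem Opp.decidedBy (h : Opp K m q) : DecidedBy K m q := by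
  intro c hc c' hc' hm
  have h1 := h c hc
  have h2 := h c' hc'
  cases h3 : c m <;> cases h4 : c q <;> cases h5 : c' m <;> cases h6 : c' q <;> simp_all

theorem decidedBy_self (m : Fin n) : DecidedBy K m m := fun _ _ _ _ h => h

theorem const_of_forall (v : Bool) (h : ∀ c ∈ K, c p = v) : Const K p :=
  fun c hc c' hc' => (h c hc).trans (h c' hc').symm

theorem Const.forall (h : Const K p) : (∀ c ∈ K, c p = true) ∨ (∀ c ∈ K, c p = false) := by
  by_cases h' : ∃ c ∈ K, c p = true
  · obtain ⟨c, hc, hcp⟩ := h'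
    exact Or.inl fun c' hc' => (h c' hc' c hc).trans hcp
  · exact Or.inr fun c hc => by
      rw [← Bool.not_eq_true]; exact fun hcp => h' ⟨c, hc, hcp⟩

/-- `b` is known to be `true` and `x` to be `false`. Between two such balls any two others can be
compared. -/
def Anchored (K : Set (Fin n → Bool)) (b x : Fin n) : Prop := ∀ c ∈ K, c b = true ∧ c x = false

variable {b x : Fin n}

theorem Anchored.mono (h : Anchored K b x) (hK : K' ⊆ K) : Anchored K' b x :=
  fun c hc => h c (hK hc)

/-- The query `{b, p, q}` either orders `p` and `q` or shows that one of them is `true`; in the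
second case `{x, p, q}` either orders them or shows that one of them is `false`. -/
theorem learnable_compare (hK : Anchored K b x) (hpb : p ≠ b) (hpx : p ≠ x) (hqb : q ≠ b)
    (hqx : q ≠ x) (hpq : p ≠ q) :
    Learnable (fun L => Le L p q ∨ Le L q p ∨ Opp L p q) K 2 := by
  refine Learnable.ask_triple hpb.symm hqb.symm hpq (fun K' hK' h => ?_) (fun K' hK' h => ?_)
    (fun K' hK' h => ?_)
  · refine Learnable.ask_triple hpx.symm hqx.symm hpq (fun L hL h' => ?_) (fun L hL h' => ?_)
      (fun L hL h' => ?_)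
    · refine .done (Or.inr (Or.inr fun c hc => ?_))
      have h1 := h c (hL hc)
      have h2 := h' c hc
      have h3 := hK c (hK' (hL hc))
      rw [h3.1] at h1; rw [h3.2] at h2
      rcases h1 with h1 | h1 <;> rcases h2 with h2 | h2 <;> simp_all
    · refine .done (Or.inl fun c hc hp => ?_)
      have h2 := h' c hc
      have h3 := hK c (hK' (hL hc))
      rw [h3.2, hp] at h2
      simpa using h2
    · refine .done (Or.inr (Or.inl fun c hc hp => ?_))
      have h2 := h' c hc
      have h3 := hK c (hK' (hL hc))
      rw [h3.2, hp] at h2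
      simpa using h2
  · refine .done (Or.inr (Or.inl fun c hc hp => ?_))
    have h2 := h c hc
    have h3 := hK c (hK' hc)
    rw [h3.1, hp] at h2
    rcases h2 with h2 | h2 <;> exact h2.symm
  · refine .done (Or.inl fun c hc hp => ?_)
    have h2 := h c hc
    have h3 := hK c (hK' hc)
    rw [h3.1, hp] at h2
    rcases h2 with h2 | h2 <;> exact h2.symm

/-- The comparisons of one ball with both members of a pair of opposite colours. -/
theorem learnable_const_or_decidedBy (hK : Anchored K b x) (hmb : m ≠ b) (hmx : m ≠ x)
    (hpb : p ≠ b) (hpx : p ≠ x) (hqb : q ≠ b) (hqx : q ≠ x) (h : Opp K m p) :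
    Learnable (fun L => DecidedBy L m q ∨ Const L m) K 4 := by
  by_cases hqm : q = m
  · exact .done (Or.inl (hqm ▸ decidedBy_self _))
  by_cases hqp : q = p
  · exact .done (Or.inl (hqp ▸ h.decidedBy))
  refine (learnable_compare hK hmb hmx hqb hqx (Ne.symm hqm)).bind (k' := 2) fun L hL h1 => ?_
  rcases h1 with h1 | h1 | h1
  · refine (learnable_compare (hK.mono hL) hpb hpx hqb hqx (Ne.symm hqp)).imp fun L' hL' h2 => ?_
    rcases h2 with h2 | h2 | h2
    · refine Or.inl (Const.decidedBy (const_of_forall true fun c hc => ?_) _)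
      have e1 := h1 c (hL' hc); have e2 := h2 c hc; have e3 := h c (hL (hL' hc))
      cases h4 : c m <;> cases h5 : c p <;> cases h6 : c q <;> simp_all
    · refine Or.inr (const_of_forall false fun c hc => ?_)
      have e1 := h1 c (hL' hc); have e2 := h2 c hc; have e3 := h c (hL (hL' hc))
      cases h4 : c m <;> cases h5 : c p <;> cases h6 : c q <;> simp_all
    · left
      have key : ∀ c ∈ L', c q = c m := fun c hc => by
        have e2 := h2 c hc; have e3 := h c (hL (hL' hc))
        cases h4 : c m <;> cases h5 : c p <;> cases h6 : c q <;> simp_all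
      intro c hc c' hc' e
      rw [key c hc, key c' hc', e]
  · refine (learnable_compare (hK.mono hL) hpb hpx hqb hqx (Ne.symm hqp)).imp fun L' hL' h2 => ?_
    rcases h2 with h2 | h2 | h2
    · refine Or.inr (const_of_forall true fun c hc => ?_)
      have e1 := h1 c (hL' hc); have e2 := h2 c hc; have e3 := h c (hL (hL' hc))
      cases h4 : c m <;> cases h5 : c p <;> cases h6 : c q <;> simp_all
    · refine Or.inl (Const.decidedBy (const_of_forall false fun c hc => ?_) _)
      have e1 := h1 c (hL' hc); have e2 := h2 c hc; have e3 := h c (hL (hL' hc))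
      cases h4 : c m <;> cases h5 : c p <;> cases h6 : c q <;> simp_all
    · left
      have key : ∀ c ∈ L', c q = c m := fun c hc => by
        have e2 := h2 c hc; have e3 := h c (hL (hL' hc))
        cases h4 : c m <;> cases h5 : c p <;> cases h6 : c q <;> simp_all
      intro c hc c' hc' e
      rw [key c hc, key c' hc', e]
  · exact .done (Or.inl h1.decidedBy)

variable {P : Finset (Fin n)}

theorem learnable_const_or_forall_decidedBy (hK : Anchored K b x) (hb : b ∉ P) (hx : x ∉ P)
    (hm : m ∈ P) (hp : p ∈ P) (h : Opp K m p) :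
    Learnable (fun L => (∀ q ∈ P, DecidedBy L m q) ∨ Const L m) K (4 * P.card) := by
  have hne : ∀ q ∈ P, q ≠ b ∧ q ≠ x := fun q hq =>
    ⟨fun e => hb (e ▸ hq), fun e => hx (e ▸ hq)⟩
  exact Learnable.forall_or (antitone_decidedBy m) P fun q hq K' hK' =>
    learnable_const_or_decidedBy (hK.mono hK') (hne m hm).1 (hne m hm).2 (hne p hp).1
      (hne p hp).2 (hne q hq).1 (hne q hq).2 (antitone_opp m p hK' h)

/-- Comparing `m` with all of `P`, either `m` becomes comparable to every ball of `P` or a ball of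
the opposite colour turns up. -/
theorem learnable_comparable_or_opp (hK : Anchored K b x) (hb : b ∉ P) (hx : x ∉ P)
    (hm : m ∈ P) :
    Learnable (fun L => (∀ q ∈ P, Le L q m ∨ Le L m q) ∨ ∃ p ∈ P, m ≠ p ∧ Opp L m p) K
      (2 * P.card) := by
  have hne : ∀ q ∈ P, q ≠ b ∧ q ≠ x := fun q hq =>
    ⟨fun e => hb (e ▸ hq), fun e => hx (e ▸ hq)⟩
  refine Learnable.forall_or (G := fun q L => Le L q m ∨ Le L m q)
    (fun q _ _ hL h => h.imp (antitone_le _ _ hL) (antitone_le _ _ hL)) P fun q hq K' hK' => ?_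
  by_cases hmq : m = q
  · subst hmq; exact .done (Or.inl (Or.inl (le_refl _)))
  refine (learnable_compare (hK.mono hK') (hne m hm).1 (hne m hm).2 (hne q hq).1 (hne q hq).2
    hmq).imp fun L _ h => ?_
  rcases h with h | h | h
  · exact Or.inl (Or.inr h)
  · exact Or.inl (Or.inl h)
  · exact Or.inr ⟨q, hq, hmq, h⟩

theorem learnable_forall_comparable_or_opp (hK : Anchored K b x) (hb : b ∉ P) (hx : x ∉ P) :
    Learnable (fun L => (∀ m ∈ P, ∀ q ∈ P, Le L q m ∨ Le L m q) ∨
      ∃ m ∈ P, ∃ p ∈ P, m ≠ p ∧ Opp L m p) K (2 * P.card * P.card) := by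
  refine Learnable.forall_or (G := fun m L => ∀ q ∈ P, Le L q m ∨ Le L m q)
    (fun m _ _ hL h q hq => (h q hq).imp (antitone_le _ _ hL) (antitone_le _ _ hL)) P
    fun m hm K' hK' => ?_
  exact (learnable_comparable_or_opp (hK.mono hK') hb hx hm).imp fun L _ h =>
    h.imp_right fun h => ⟨m, hm, h⟩

end Relations

/-! ### Selection between two anchors -/

section Selection

open scoped Classical

variable {n : ℕ} {K K' L : Set (Fin n → Bool)} {m p q r b x : Fin n} {P : Finset (Fin n)}
  {k t : ℕ}

/-- Some ball of `P` is known to be a `k`-th smallest one in the order `false ≤ true`, with known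
witnesses: at least `k` balls of `P` lie below it and at least `|P| + 1 - k` above it, itself
counted in both. -/
def HasRank (K : Set (Fin n → Bool)) (P : Finset (Fin n)) (k : ℕ) : Prop :=
  ∃ y ∈ P, k ≤ (P.filter (Le K · y)).card ∧ P.card + 1 ≤ (P.filter (Le K y ·)).card + k

/-- At most two colourings of `P` are left, and `P` contains two balls of opposite colours. -/
def Decided (K : Set (Fin n → Bool)) (P : Finset (Fin n)) : Prop :=
  ∃ m ∈ P, ∃ p ∈ P, Opp K m p ∧ ∀ q ∈ P, DecidedBy K m q

/-- What a selection of the `k`-th smallest ball of `P` is to achieve. -/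
def Selected (P : Finset (Fin n)) (k : ℕ) (K : Set (Fin n → Bool)) : Prop :=
  HasRank K P k ∨ Decided K P

/-- Balls of known colour can be left out of a selection. -/
theorem learnable_selected_of_const {O : Finset (Fin n)} (hO : O ⊆ P) (hc : ∀ o ∈ O, Const K o)
    (hk : 1 ≤ k) (hkP : k ≤ P.card)
    (ih : ∀ j, 1 ≤ j → j ≤ (P \ O).card → Learnable (Selected (P \ O) j) K t) :
    Learnable (Selected P k) K t := by
  set Z := O.filter fun z => ∀ c ∈ K, c z = false with hZ
  have hZO : Z ⊆ O := Finset.filter_subset _ _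
  set W := O \ Z with hW
  have hWt : ∀ w ∈ W, ∀ c ∈ K, c w = true := by
    intro w hw
    have hwO := (Finset.mem_sdiff.1 hw).1
    rcases (hc w hwO).forall with h | h
    · exact h
    · exact absurd (Finset.mem_filter.2 ⟨hwO, h⟩) (Finset.mem_sdiff.1 hw).2
  have hZf : ∀ z ∈ Z, ∀ c ∈ K, c z = false := fun z hz => (Finset.mem_filter.1 hz).2
  have hcard : P.card = (P \ O).card + Z.card + W.card := by
    have h1 := Finset.card_sdiff_add_card_eq_card hO
    have h2 : W.card + Z.card = O.card := Finset.card_sdiff_add_card_eq_card hZO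
    omega
  by_cases hkZ : k ≤ Z.card
  · obtain ⟨y, hy⟩ : Z.Nonempty := Finset.card_pos.1 (by omega)
    refine .done (Or.inl ⟨y, hO (hZO hy), hkZ.trans (Finset.card_le_card fun z hz => ?_), ?_⟩)
    · refine Finset.mem_filter.2 ⟨hO (hZO hz), fun c hcK h => ?_⟩
      rw [hZf z hz c hcK] at h; exact absurd h (by simp)
    · rw [Finset.filter_true_of_mem]
      · omega
      · intro q _ c hcK h
        rw [hZf y hy c hcK] at h; exact absurd h (by simp)
  by_cases hkW : P.card + 1 ≤ W.card + k
  · obtain ⟨y, hy⟩ : W.Nonempty := Finset.card_pos.1 (by omega)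
    have hWP : W ⊆ P := Finset.sdiff_subset.trans hO
    refine .done (Or.inl ⟨y, hWP hy, ?_, hkW.trans (Nat.add_le_add_right
      (Finset.card_le_card fun z hz => ?_) _)⟩)
    · rw [Finset.filter_true_of_mem]
      · exact hkP
      · intro q _ c hcK _
        exact hWt y hy c hcK
    · exact Finset.mem_filter.2 ⟨hWP hz, fun c hcK _ => hWt z hz c hcK⟩
  refine (ih (k - Z.card) (by omega) (by omega)).imp fun L hL h => ?_
  rcases h with ⟨y, hy, h1, h2⟩ | ⟨m, hm, p, hp, hmp, h⟩
  · refine Or.inl ⟨y, Finset.sdiff_subset hy, ?_, ?_⟩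
    · have hsub : (P \ O).filter (Le L · y) ∪ Z ⊆ P.filter (Le L · y) := by
        refine Finset.union_subset
          (Finset.filter_subset_filter _ Finset.sdiff_subset) fun z hz => ?_
        refine Finset.mem_filter.2 ⟨hO (hZO hz), fun c hcL h => ?_⟩
        rw [hZf z hz c (hL hcL)] at h; exact absurd h (by simp)
      have hd : Disjoint ((P \ O).filter (Le L · y)) Z :=
        (Finset.sdiff_disjoint.mono_right hZO).mono_left (Finset.filter_subset _ _)
      have := Finset.card_le_card hsub
      rw [Finset.card_union_of_disjoint hd] at this
      omega
    · have hsub : (P \ O).filter (Le L y ·) ∪ W ⊆ P.filter (Le L y ·) := by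
        refine Finset.union_subset
          (Finset.filter_subset_filter _ Finset.sdiff_subset) fun z hz => ?_
        exact Finset.mem_filter.2 ⟨hO (Finset.sdiff_subset hz),
          fun c hcL _ => hWt z hz c (hL hcL)⟩
      have hd : Disjoint ((P \ O).filter (Le L y ·)) W :=
        (Finset.sdiff_disjoint.mono_right Finset.sdiff_subset).mono_left
          (Finset.filter_subset _ _)
      have := Finset.card_le_card hsub
      rw [Finset.card_union_of_disjoint hd] at this
      omega
  · refine Or.inr ⟨m, Finset.sdiff_subset hm, p, Finset.sdiff_subset hp, hmp, fun q hq => ?_⟩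
    by_cases hqO : q ∈ O
    · exact (antitone_const q hL (hc q hqO)).decidedBy m
    · exact h q (Finset.mem_sdiff.2 ⟨hq, hqO⟩)

/-- A ball `m` comparable to all of `P` serves as a pivot: either it has rank `k` itself, or the
selection goes on among the balls strictly below it, or among those strictly above it. -/
theorem learnable_selected_of_pivot (hm : m ∈ P) (hcmp : ∀ q ∈ P, Le K q m ∨ Le K m q)
    (hk : 1 ≤ k) (hkP : k ≤ P.card)
    (ihU : ∀ j, 1 ≤ j → j ≤ (P.filter (¬ Le K m ·)).card →
      Learnable (Selected (P.filter (¬ Le K m ·)) j) K t)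
    (ihD : ∀ j, 1 ≤ j → j ≤ (P.filter (¬ Le K · m)).card →
      Learnable (Selected (P.filter (¬ Le K · m)) j) K t) :
    Learnable (Selected P k) K t := by
  set U := P.filter (¬ Le K m ·) with hU
  set D := P.filter (¬ Le K · m) with hD
  have cU : (P.filter (Le K m ·)).card + U.card = P.card :=
    Finset.card_filter_add_card_filter_not _
  have cD : (P.filter (Le K · m)).card + D.card = P.card :=
    Finset.card_filter_add_card_filter_not _
  have hUm : ∀ u ∈ U, Le K u m := fun u hu =>
    (hcmp u (Finset.mem_filter.1 hu).1).resolve_right (Finset.mem_filter.1 hu).2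
  have hDm : ∀ u ∈ D, Le K m u := fun u hu =>
    (hcmp u (Finset.mem_filter.1 hu).1).resolve_left (Finset.mem_filter.1 hu).2
  have hUP : U ⊆ P := Finset.filter_subset _ _
  have hDP : D ⊆ P := Finset.filter_subset _ _
  by_cases h1 : k ≤ U.card
  · refine (ihU k hk h1).imp fun L hL h => ?_
    rcases h with ⟨y, hy, h1, h2⟩ | ⟨m', hm', p, hp, hmp, h⟩
    · refine Or.inl ⟨y, hUP hy, h1.trans (Finset.card_le_card
        (Finset.filter_subset_filter _ hUP)), ?_⟩
      have hsub : U.filter (Le L y ·) ∪ P.filter (Le K m ·) ⊆ P.filter (Le L y ·) := by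
        refine Finset.union_subset (Finset.filter_subset_filter _ hUP) fun z hz => ?_
        obtain ⟨hzP, hz⟩ := Finset.mem_filter.1 hz
        exact Finset.mem_filter.2 ⟨hzP, antitone_le _ _ hL ((hUm y hy).trans hz)⟩
      have hd : Disjoint (U.filter (Le L y ·)) (P.filter (Le K m ·)) :=
        (Finset.disjoint_filter_filter_not P P _).symm.mono_left (Finset.filter_subset _ _)
      have := Finset.card_le_card hsub
      rw [Finset.card_union_of_disjoint hd] at this
      omega
    · -- two balls of opposite colours below `m` force the colour of `m`, and of all above it
      have hmt : ∀ c ∈ L, c m = true := fun c hc => by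
        have e1 := hUm m' hm' c (hL hc)
        have e2 := hUm p hp c (hL hc)
        have e3 := hmp c hc
        cases h4 : c m'
        · exact e2 (by cases h5 : c p <;> simp_all)
        · exact e1 h4
      refine Or.inr ⟨m', hUP hm', p, hUP hp, hmp, fun q hq => ?_⟩
      by_cases hqU : q ∈ U
      · exact h q hqU
      · have hmq : Le K m q := by
          by_contra hn; exact hqU (Finset.mem_filter.2 ⟨hq, hn⟩)
        exact (const_of_forall true fun c hc => hmq c (hL hc) (hmt c hc)).decidedBy _
  by_cases h2 : (P.filter (Le K · m)).card < k
  · refine (ihD (k - (P.filter (Le K · m)).card) (by omega) (by omega)).imp fun L hL h => ?_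
    rcases h with ⟨y, hy, h1, h2⟩ | ⟨m', hm', p, hp, hmp, h⟩
    · refine Or.inl ⟨y, hDP hy, ?_, ?_⟩
      · have hsub : D.filter (Le L · y) ∪ P.filter (Le K · m) ⊆ P.filter (Le L · y) := by
          refine Finset.union_subset (Finset.filter_subset_filter _ hDP) fun z hz => ?_
          obtain ⟨hzP, hz⟩ := Finset.mem_filter.1 hz
          exact Finset.mem_filter.2 ⟨hzP, antitone_le _ _ hL (hz.trans (hDm y hy))⟩
        have hd : Disjoint (D.filter (Le L · y)) (P.filter (Le K · m)) :=
          (Finset.disjoint_filter_filter_not P P _).symm.mono_left (Finset.filter_subset _ _)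
        have := Finset.card_le_card hsub
        rw [Finset.card_union_of_disjoint hd] at this
        omega
      · have := Finset.card_le_card (Finset.filter_subset_filter (Le L y ·) hDP)
        omega
    · have hmt : ∀ c ∈ L, c m = false := fun c hc => by
        have e1 := hDm m' hm' c (hL hc)
        have e2 := hDm p hp c (hL hc)
        have e3 := hmp c hc
        cases h6 : c m
        · rfl
        · exact absurd ((e1 h6).trans (e2 h6).symm) e3
      refine Or.inr ⟨m', hDP hm', p, hDP hp, hmp, fun q hq => ?_⟩
      by_cases hqD : q ∈ D
      · exact h q hqD
      · have hmq : Le K q m := by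
          by_contra hn; exact hqD (Finset.mem_filter.2 ⟨hq, hn⟩)
        exact (const_of_forall false fun c hc => hmq.eq_false (hL hc) (hmt c hc)).decidedBy _
  · exact .done (Or.inl ⟨m, hm, by omega, by omega⟩)

/-- One round of the selection with a ball `m` that has at least `r` known balls on either side.
If a ball of the colour opposite to `m` turns up, then `P` gets decided, or the colour of `m` and
hence that of one of the two sides becomes known. -/
theorem learnable_selected_step (hK : Anchored K b x) (hb : b ∉ P) (hx : x ∉ P) (hm : m ∈ P)
    {r : ℕ} (hA : r ≤ (P.filter (Le K · m)).card) (hB : r ≤ (P.filter (Le K m ·)).card)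
    (hk : 1 ≤ k) (hkP : k ≤ P.card)
    (ih : ∀ R ⊆ P, R.card + r ≤ P.card → ∀ L ⊆ K, ∀ j, 1 ≤ j → j ≤ R.card →
      Learnable (Selected R j) L t) :
    Learnable (Selected P k) K (6 * P.card + t) := by
  suffices Learnable (Selected P k) K (2 * P.card + (4 * P.card + t)) from
    this.mono_cost (by omega)
  refine (learnable_comparable_or_opp hK hb hx hm).bind fun K₁ hK₁ h => ?_
  rcases h with h | ⟨p, hp, -, hmp⟩
  · refine (learnable_selected_of_pivot (t := t) hm h hk hkP ?_ ?_).mono_cost (by omega)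
    · refine ih _ (Finset.filter_subset _ _) ?_ K₁ hK₁
      have h1 : (P.filter (Le K₁ m ·)).card + (P.filter (¬ Le K₁ m ·)).card = P.card :=
        Finset.card_filter_add_card_filter_not _
      have h2 : (P.filter (Le K m ·)).card ≤ (P.filter (Le K₁ m ·)).card :=
        Finset.card_le_card (Finset.monotone_filter_right _ fun q _ => antitone_le _ _ hK₁)
      omega
    · refine ih _ (Finset.filter_subset _ _) ?_ K₁ hK₁
      have h1 : (P.filter (Le K₁ · m)).card + (P.filter (¬ Le K₁ · m)).card = P.card :=
        Finset.card_filter_add_card_filter_not _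
      have h2 : (P.filter (Le K · m)).card ≤ (P.filter (Le K₁ · m)).card :=
        Finset.card_le_card (Finset.monotone_filter_right _ fun q _ => antitone_le _ _ hK₁)
      omega
  · refine (learnable_const_or_forall_decidedBy (hK.mono hK₁) hb hx hm hp hmp).bind
      fun K₂ hK₂ h => ?_
    rcases h with h | h
    · exact .done (Or.inr ⟨m, hm, p, hp, antitone_opp _ _ hK₂ hmp, h⟩)
    · have hsub := hK₂.trans hK₁
      rcases h.forall with h | h
      · refine learnable_selected_of_const (O := P.filter (Le K m ·)) (Finset.filter_subset _ _)
          (fun o ho => const_of_forall true fun c hc => ?_) hk hkP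
          (ih _ Finset.sdiff_subset ?_ K₂ hsub)
        · exact (Finset.mem_filter.1 ho).2 c (hsub hc) (h c hc)
        · have := Finset.card_sdiff_add_card_eq_card (Finset.filter_subset (Le K m ·) P)
          omega
      · refine learnable_selected_of_const (O := P.filter (Le K · m)) (Finset.filter_subset _ _)
          (fun o ho => const_of_forall false fun c hc => ?_) hk hkP
          (ih _ Finset.sdiff_subset ?_ K₂ hsub)
        · exact (Finset.mem_filter.1 ho).2.eq_false (hsub hc) (h c hc)
        · have := Finset.card_sdiff_add_card_eq_card (Finset.filter_subset (Le K · m) P)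
          omega

/-- Every rank is attained in a set whose balls are pairwise comparable. -/
theorem hasRank_of_comparable (h : ∀ m ∈ P, ∀ q ∈ P, Le K q m ∨ Le K m q) :
    ∀ k, 1 ≤ k → k ≤ P.card → HasRank K P k := by
  induction hs : P.card generalizing P with
  | zero => intro k h1 h2; omega
  | succ s ih =>
    intro k h1 h2
    -- a largest ball is split off
    obtain ⟨m, hm, hmax⟩ : ∃ m ∈ P, ∀ q ∈ P, Le K q m := by
      have hne : P.Nonempty := Finset.card_pos.1 (by omega)
      clear hs ih h2
      induction hne using Finset.Nonempty.cons_induction with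
      | singleton a => exact ⟨a, by simp, by simp [le_refl]⟩
      | cons a S ha hS ihS =>
        obtain ⟨m, hm, hmax⟩ := ihS fun u hu v hv =>
          h u (Finset.mem_cons_of_mem hu) v (Finset.mem_cons_of_mem hv)
        rcases h m (Finset.mem_cons_of_mem hm) a (Finset.mem_cons_self _ _) with h' | h'
        · refine ⟨m, Finset.mem_cons_of_mem hm, fun q hq => ?_⟩
          rcases Finset.mem_cons.1 hq with rfl | hq
          · exact h'
          · exact hmax q hq
        · refine ⟨a, Finset.mem_cons_self _ _, fun q hq => ?_⟩
          rcases Finset.mem_cons.1 hq with rfl | hq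
          · exact le_refl _
          · exact (hmax q hq).trans h'
    by_cases hks : k = s + 1
    · refine ⟨m, hm, ?_, ?_⟩
      · rw [Finset.filter_true_of_mem hmax]; omega
      · have : 0 < (P.filter (Le K m ·)).card :=
          Finset.card_pos.2 ⟨m, Finset.mem_filter.2 ⟨hm, le_refl _⟩⟩
        omega
    · have hc : (P.erase m).card = s := by rw [Finset.card_erase_of_mem hm]; omega
      obtain ⟨y, hy, h3, h4⟩ := ih (P := P.erase m) (fun u hu v hv =>
        h u (Finset.mem_of_mem_erase hu) v (Finset.mem_of_mem_erase hv)) hc k h1 (by omega)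
      refine ⟨y, Finset.mem_of_mem_erase hy, h3.trans (Finset.card_le_card
        (Finset.filter_subset_filter _ (Finset.erase_subset _ _))), ?_⟩
      have hsub : insert m ((P.erase m).filter (Le K y ·)) ⊆ P.filter (Le K y ·) := by
        refine Finset.insert_subset (Finset.mem_filter.2 ⟨hm, hmax y (Finset.mem_of_mem_erase hy)⟩)
          (Finset.filter_subset_filter _ (Finset.erase_subset _ _))
      have := Finset.card_le_card hsub
      rw [Finset.card_insert_of_notMem (by simp)] at this
      omega

/-- Up to the set `E`, all balls of `P` but at most four lie in disjoint blocks of five balls; the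
block `B m` of `m ∈ Q` has `m` as a known median. Every ball of `E` has one of the opposite colour
in `E`. -/
structure BlockDecomposition (K : Set (Fin n → Bool)) (P E Q : Finset (Fin n))
    (B : Fin n → Finset (Fin n)) : Prop where
  subset : E ⊆ P
  exists_opp : ∀ r ∈ E, ∃ s ∈ E, Opp K r s
  block_subset : ∀ m ∈ Q, B m ⊆ P \ E
  mem_block : ∀ m ∈ Q, m ∈ B m
  card_block : ∀ m ∈ Q, (B m).card = 5
  card_below : ∀ m ∈ Q, 3 ≤ ((B m).filter (Le K · m)).card
  card_above : ∀ m ∈ Q, 3 ≤ ((B m).filter (Le K m ·)).card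
  disjoint : (Q : Set (Fin n)).PairwiseDisjoint B
  card_le : P.card ≤ E.card + 5 * Q.card + 4

theorem learnable_blockDecomposition (hK : Anchored K b x) (hb : b ∉ P) (hx : x ∉ P) :
    Learnable (fun L => ∃ E Q B, BlockDecomposition L P E Q B) K (25 * P.card) := by
  induction hs : P.card using Nat.strong_induction_on generalizing P K with
  | _ s ih =>
  by_cases h4 : s ≤ 4
  · exact .done ⟨∅, ∅, fun _ => ∅, by constructor <;> simp; omega⟩
  obtain ⟨T, hTP, hT⟩ := Finset.exists_subset_card_eq (s := P) (n := 5) (by omega)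
  have hcT := Finset.card_sdiff_add_card_eq_card hTP
  refine ((learnable_forall_comparable_or_opp (P := T) hK (fun h => hb (hTP h))
    (fun h => hx (hTP h))).bind (k' := 25 * (s - 2)) fun K₁ hK₁ h => ?_).mono_cost
    (by rw [hT]; omega)
  rcases h with h | ⟨p, hp, q, hq, hpq, hopp⟩
  · obtain ⟨m, hm, h1, h2⟩ := hasRank_of_comparable h 3 (by norm_num) (by omega)
    refine ((ih (P \ T).card (by omega) (hK.mono hK₁) (fun h => hb (Finset.sdiff_subset h))
      (fun h => hx (Finset.sdiff_subset h)) rfl).imp fun L hL hG => ?_).mono_cost (by omega)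
    obtain ⟨E, Q, B, hd⟩ := hG
    have hmQ : ∀ q ∈ Q, q ≠ m := by
      rintro q hq rfl
      have := Finset.sdiff_subset (hd.block_subset q hq (hd.mem_block q hq))
      exact (Finset.mem_sdiff.1 this).2 hm
    have hB : ∀ q ∈ Q, Function.update B m T q = B q := fun q hq =>
      Function.update_of_ne (hmQ q hq) _ _
    have hBm : Function.update B m T m = T := Function.update_self _ _ _
    have hET : Disjoint T E := Finset.disjoint_sdiff.mono_right hd.subset
    refine ⟨E, insert m Q, Function.update B m T, ?_⟩
    refine ⟨hd.subset.trans Finset.sdiff_subset, hd.exists_opp, ?_, ?_, ?_, ?_, ?_, ?_, ?_⟩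
    · refine Finset.forall_mem_insert _ _ _ |>.2 ⟨?_, fun q hq => ?_⟩
      · rw [hBm]; exact Finset.subset_sdiff.2 ⟨hTP, hET⟩
      · rw [hB q hq]
        exact (hd.block_subset q hq).trans
          (Finset.sdiff_subset_sdiff Finset.sdiff_subset subset_rfl)
    · refine Finset.forall_mem_insert _ _ _ |>.2 ⟨?_, fun q hq => ?_⟩
      · rw [hBm]; exact hm
      · rw [hB q hq]; exact hd.mem_block q hq
    · refine Finset.forall_mem_insert _ _ _ |>.2 ⟨?_, fun q hq => ?_⟩
      · rw [hBm]; exact hT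
      · rw [hB q hq]; exact hd.card_block q hq
    · refine Finset.forall_mem_insert _ _ _ |>.2 ⟨?_, fun q hq => ?_⟩
      · rw [hBm]
        exact h1.trans (Finset.card_le_card
          (Finset.monotone_filter_right _ fun q _ => antitone_le _ _ hL))
      · rw [hB q hq]; exact hd.card_below q hq
    · refine Finset.forall_mem_insert _ _ _ |>.2 ⟨?_, fun q hq => ?_⟩
      · rw [hBm]
        have h3 : 3 ≤ (T.filter (Le K₁ m ·)).card := by omega
        exact h3.trans (Finset.card_le_card
          (Finset.monotone_filter_right _ fun q _ => antitone_le _ _ hL))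
      · rw [hB q hq]; exact hd.card_above q hq
    · rw [Finset.coe_insert]
      refine Set.PairwiseDisjoint.insert ?_ fun q hq _ => ?_
      · intro u hu v hv huv
        have := hd.disjoint hu hv huv
        simp only [Function.onFun] at this ⊢
        rwa [hB u hu, hB v hv]
      · rw [hBm, hB q hq]
        exact Finset.disjoint_sdiff.mono_right
          ((hd.block_subset q hq).trans Finset.sdiff_subset)
    · rw [Finset.card_insert_of_notMem fun h => hmQ m h rfl]
      have := hd.card_le
      omega
  · have hsub : ({p, q} : Finset (Fin n)) ⊆ P := by
      intro u hu
      rcases Finset.mem_insert.1 hu with rfl | hu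
      · exact hTP hp
      · rw [Finset.mem_singleton.1 hu]; exact hTP hq
    have hc := Finset.card_sdiff_add_card_eq_card hsub
    have hc2 := Finset.card_pair hpq
    refine ((ih (P \ {p, q}).card (by omega) (hK.mono hK₁) (fun h => hb (Finset.sdiff_subset h))
      (fun h => hx (Finset.sdiff_subset h)) rfl).imp fun L hL hG => ?_).mono_cost (by omega)
    obtain ⟨E, Q, B, hd⟩ := hG
    have hdE : Disjoint {p, q} E := Finset.disjoint_sdiff.mono_right hd.subset
    refine ⟨{p, q} ∪ E, Q, B, Finset.union_subset hsub (hd.subset.trans Finset.sdiff_subset), ?_,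
      fun m hm => ?_, hd.mem_block, hd.card_block, hd.card_below, hd.card_above, hd.disjoint, ?_⟩
    · intro r hr
      rcases Finset.mem_union.1 hr with hr | hr
      · rcases Finset.mem_insert.1 hr with rfl | hr
        · exact ⟨q, by simp, antitone_opp _ _ hL hopp⟩
        · rw [Finset.mem_singleton.1 hr]
          exact ⟨p, by simp, antitone_opp _ _ hL hopp.symm⟩
      · obtain ⟨s, hs, h⟩ := hd.exists_opp r hr
        exact ⟨s, Finset.mem_union_right _ hs, h⟩
    · refine (hd.block_subset m hm).trans fun u hu => ?_
      simp only [Finset.mem_union, Finset.mem_sdiff] at hu ⊢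
      tauto
    · rw [Finset.card_union_of_disjoint hdE]
      have := hd.card_le
      omega

/-- Any number of pairs of opposite colours can be resolved at linear cost. A ball `m` that decides
the pairs seen so far is kept. Comparing it and its opposite with a new ball `r` either decides
`r` as well, or reveals the colour of `m`, whereupon all earlier pairs are known and `r` can take
the place of `m`. -/
theorem learnable_forall_const_or_decided (hK : Anchored K b x) (hb : b ∉ P) (hx : x ∉ P)
    {E : Finset (Fin n)} (hE : E ⊆ P) (hopp : ∀ r ∈ E, ∃ s ∈ P, Opp K r s) :
    Learnable (fun L => (∀ r ∈ E, Const L r) ∨ Decided L P) K (8 * P.card) := by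
  have hne : ∀ q ∈ P, q ≠ b ∧ q ≠ x := fun q hq =>
    ⟨fun e => hb (e ▸ hq), fun e => hx (e ▸ hq)⟩
  have key : Learnable (fun L => E = ∅ ∨ ∃ m ∈ P, ∃ p ∈ P, Opp L m p ∧ ∀ r ∈ E, DecidedBy L m r)
      K (4 * E.card) := by
    induction E using Finset.induction_on with
    | empty => exact .done (Or.inl rfl)
    | insert r E hr ih =>
      rw [Finset.card_insert_of_notMem hr, mul_add]
      refine (ih (fun u hu => hE (Finset.mem_insert_of_mem hu))
        fun u hu => hopp u (Finset.mem_insert_of_mem hu)).bind fun L hL h => ?_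
      have hrP := hE (Finset.mem_insert_self r E)
      obtain ⟨s, hs, hrs⟩ := hopp r (Finset.mem_insert_self _ _)
      rcases h with rfl | ⟨m, hm, p, hp, hmp, h⟩
      · refine .done (Or.inr ⟨r, hrP, s, hs, antitone_opp _ _ hL hrs, fun u hu => ?_⟩)
        obtain rfl : u = r := by simpa using hu
        exact decidedBy_self _
      · refine (learnable_const_or_decidedBy (q := r) (hK.mono hL) (hne m hm).1 (hne m hm).2
          (hne p hp).1 (hne p hp).2 (hne r hrP).1 (hne r hrP).2 hmp).imp fun L' hL' h' => Or.inr ?_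
        rcases h' with h' | h'
        · refine ⟨m, hm, p, hp, antitone_opp _ _ hL' hmp,
            Finset.forall_mem_insert _ _ _ |>.2 ⟨h', fun u hu => ?_⟩⟩
          exact antitone_decidedBy _ _ hL' (h u hu)
        · refine ⟨r, hrP, s, hs, antitone_opp _ _ (hL'.trans hL) hrs,
            Finset.forall_mem_insert _ _ _ |>.2 ⟨decidedBy_self _, fun u hu => ?_⟩⟩
          exact ((antitone_decidedBy _ _ hL' (h u hu)).const h').decidedBy _
  have hcard := Finset.card_le_card hE
  suffices Learnable (fun L => (∀ r ∈ E, Const L r) ∨ Decided L P) K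
      (4 * E.card + 4 * P.card) from this.mono_cost (by omega)
  refine key.bind fun L hL h => ?_
  rcases h with rfl | ⟨m, hm, p, hp, hmp, h⟩
  · exact .done (Or.inl (by simp))
  · refine (learnable_const_or_forall_decidedBy (hK.mono hL) hb hx hm hp hmp).imp
      fun L' hL' h' => ?_
    rcases h' with h' | h'
    · exact Or.inr ⟨m, hm, p, hp, antitone_opp _ _ hL' hmp, h'⟩
    · exact Or.inl fun r hr => (antitone_decidedBy _ _ hL' (h r hr)).const h'

/-- In a union of disjoint blocks, a property that holds for three balls of each block of `S`
holds for `3 |S|` balls. -/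
theorem three_mul_card_le {Q S R : Finset (Fin n)} {B : Fin n → Finset (Fin n)}
    {φ : Fin n → Prop} (hS : S ⊆ Q) (hd : (Q : Set (Fin n)).PairwiseDisjoint B)
    (hB : ∀ m ∈ Q, B m ⊆ R) (h : ∀ m ∈ S, 3 ≤ ((B m).filter φ).card) :
    3 * S.card ≤ (R.filter φ).card := by
  have hsub : S.biUnion (fun m => (B m).filter φ) ⊆ R.filter φ :=
    Finset.biUnion_subset.2 fun m hm => Finset.filter_subset_filter _ (hB m (hS hm))
  have hd' : (S : Set (Fin n)).PairwiseDisjoint fun m => (B m).filter φ :=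
    fun u hu v hv huv => (hd (hS hu) (hS hv) huv).mono (Finset.filter_subset _ _)
      (Finset.filter_subset _ _)
  have h1 := Finset.card_le_card hsub
  rw [Finset.card_biUnion hd'] at h1
  have h2 := Finset.card_nsmul_le_sum S _ 3 h
  rw [smul_eq_mul] at h2
  omega

/-- Between two anchors a ball of prescribed rank can be selected at linear cost, by medians of
medians of blocks of five. -/
theorem learnable_selected (hK : Anchored K b x) (hb : b ∉ P) (hx : x ∉ P) (hk : 1 ≤ k)
    (hkP : k ≤ P.card) : Learnable (Selected P k) K (800 * P.card) := by
  induction hs : P.card using Nat.strong_induction_on generalizing P K k with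
  | _ s ih =>
  have ih' : ∀ R ⊆ P, R.card < s → ∀ L ⊆ K, ∀ j, 1 ≤ j → j ≤ R.card →
      Learnable (Selected R j) L (800 * R.card) := fun R hR hRs L hL j h1 h2 =>
    ih R.card hRs (hK.mono hL) (fun h => hb (hR h)) (fun h => hx (hR h)) h1 h2 rfl
  by_cases h8 : s < 8
  · have hcost : 2 * P.card * P.card + (4 * P.card + 800 * (s - 2)) ≤ 800 * s := by
      rw [hs] at *
      interval_cases s <;> omega
    refine ((learnable_forall_comparable_or_opp hK hb hx).bind fun K₁ hK₁ h => ?_).mono_cost hcost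
    rcases h with h | ⟨m, hm, p, hp, hne, hopp⟩
    · exact .done (Or.inl (hasRank_of_comparable h k hk hkP))
    refine (learnable_const_or_forall_decidedBy (hK.mono hK₁) hb hx hm hp hopp).bind
      fun K₂ hK₂ h => ?_
    rcases h with h | h
    · exact .done (Or.inr ⟨m, hm, p, hp, antitone_opp _ _ hK₂ hopp, h⟩)
    have hsub : ({m, p} : Finset (Fin n)) ⊆ P := by
      intro u hu
      rcases Finset.mem_insert.1 hu with rfl | hu
      · exact hm
      · rw [Finset.mem_singleton.1 hu]; exact hp
    have hc := Finset.card_sdiff_add_card_eq_card hsub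
    have hc2 := Finset.card_pair hne
    refine learnable_selected_of_const hsub (fun o ho => ?_) hk hkP fun j h1 h2 =>
      (ih' _ Finset.sdiff_subset (by omega) K₂ (hK₂.trans hK₁) j h1 h2).mono_cost (by omega)
    rcases Finset.mem_insert.1 ho with rfl | ho
    · exact h
    · rw [Finset.mem_singleton.1 ho]
      exact (antitone_opp _ _ hK₂ hopp).decidedBy.const h
  refine ((learnable_blockDecomposition hK hb hx).bind (k' := 775 * s) fun K₁ hK₁ h =>
    ?_).mono_cost (by omega)
  obtain ⟨E, Q, B, hd⟩ := h
  refine ((learnable_forall_const_or_decided (hK.mono hK₁) hb hx hd.subset fun r hr =>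
    (hd.exists_opp r hr).imp fun s hs => ⟨hd.subset hs.1, hs.2⟩).bind (k' := 767 * s)
    fun K₂ hK₂ h => ?_).mono_cost (by omega)
  rcases h with h | h
  swap
  · exact .done (Or.inr h)
  refine learnable_selected_of_const hd.subset h hk hkP fun j hj hjR => ?_
  have hcE := Finset.card_sdiff_add_card_eq_card hd.subset
  have hle := hd.card_le
  have hRP : P \ E ⊆ P := Finset.sdiff_subset
  set R := P \ E with hR
  have hbR : b ∉ R := fun h => hb (hRP h)
  have hxR : x ∉ R := fun h => hx (hRP h)
  have hK₂' : K₂ ⊆ K := hK₂.trans hK₁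
  rcases Q.eq_empty_or_nonempty with rfl | hQ
  · rw [Finset.card_empty] at hle
    exact (ih' R hRP (by omega) K₂ hK₂' j hj hjR).mono_cost (by omega)
  have hQpos := Finset.card_pos.2 hQ
  have hQR : Q ⊆ R := fun m hm => hd.block_subset m hm (hd.mem_block m hm)
  have h5 : 5 * Q.card ≤ R.card := by
    have h1 := Finset.card_le_card (Finset.biUnion_subset.2 hd.block_subset)
    rw [Finset.card_biUnion hd.disjoint, Finset.sum_congr rfl hd.card_block,
      Finset.sum_const, smul_eq_mul, ← hR] at h1
    omega
  set r := 3 * ((Q.card + 1) / 2) with hr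
  have hcost : 800 * Q.card + (6 * R.card + 800 * (R.card - r)) ≤ 767 * s := by omega
  refine ((ih' Q (hQR.trans hRP) (by omega) K₂ hK₂' ((Q.card + 1) / 2) (by omega)
    (by omega)).bind fun K₃ hK₃ h => ?_).mono_cost hcost
  have hK₃' : K₃ ⊆ K := hK₃.trans hK₂'
  have hK31 : K₃ ⊆ K₁ := hK₃.trans hK₂
  have ihR : ∀ S ⊆ R, S.card + r ≤ R.card → ∀ L ⊆ K₃, ∀ j, 1 ≤ j → j ≤ S.card →
      Learnable (Selected S j) L (800 * (R.card - r)) := fun S hS hSr L hL j h1 h2 =>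
    (ih' S (hS.trans hRP) (by omega) L (hL.trans hK₃') j h1 h2).mono_cost (by omega)
  rcases h with ⟨m, hm, h1, h2⟩ | ⟨m, hm, p, hp, hmp, h⟩
  · refine learnable_selected_step (hK.mono hK₃') hbR hxR (hQR hm) (r := r) ?_ ?_ hj hjR ihR
    · refine le_trans (Nat.mul_le_mul_left 3 h1) (three_mul_card_le (Finset.filter_subset _ _)
        hd.disjoint hd.block_subset fun u hu => ?_)
      obtain ⟨huQ, hum⟩ := Finset.mem_filter.1 hu
      exact (hd.card_below u huQ).trans (Finset.card_le_card
        (Finset.monotone_filter_right _ fun q _ hq => (antitone_le _ _ hK31 hq).trans hum))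
    · refine le_trans (Nat.mul_le_mul_left 3 (by omega :
        (Q.card + 1) / 2 ≤ (Q.filter (Le K₃ m ·)).card))
        (three_mul_card_le (Finset.filter_subset _ _) hd.disjoint hd.block_subset fun u hu => ?_)
      obtain ⟨huQ, hum⟩ := Finset.mem_filter.1 hu
      exact (hd.card_above u huQ).trans (Finset.card_le_card
        (Finset.monotone_filter_right _ fun q _ hq => hum.trans (antitone_le _ _ hK31 hq)))
  · refine ((learnable_const_or_forall_decidedBy (hK.mono hK₃') hbR hxR (hQR hm) (hQR hp)
      hmp).bind (k' := 800 * (R.card - r)) fun K₄ hK₄ h' => ?_).mono_cost (by omega)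
    rcases h' with h' | h'
    · exact .done (Or.inr ⟨m, hQR hm, p, hQR hp, antitone_opp _ _ hK₄ hmp, h'⟩)
    -- the colours of all medians are known, so three balls of each block are
    refine learnable_selected_of_const (O := R.filter (Const K₄ ·)) (Finset.filter_subset _ _)
      (fun o ho => (Finset.mem_filter.1 ho).2) hj hjR (ihR _ Finset.sdiff_subset ?_ K₄ hK₄)
    have hc := Finset.card_sdiff_add_card_eq_card (Finset.filter_subset (Const K₄ ·) R)
    have h3 : 3 * Q.card ≤ (R.filter (Const K₄ ·)).card := by
      refine three_mul_card_le subset_rfl hd.disjoint hd.block_subset fun u hu => ?_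
      have huc : Const K₄ u := (antitone_decidedBy _ _ hK₄ (h u hu)).const h'
      have hK41 := hK₄.trans hK31
      rcases huc.forall with hv | hv
      · refine (hd.card_above u hu).trans (Finset.card_le_card
          (Finset.monotone_filter_right _ fun q _ hq => const_of_forall true fun c hc => ?_))
        exact hq c (hK41 hc) (hv c hc)
      · refine (hd.card_below u hu).trans (Finset.card_le_card
          (Finset.monotone_filter_right _ fun q _ hq => const_of_forall false fun c hc => ?_))
        exact hq.eq_false (hK41 hc) (hv c hc)
    omega

end Selection

/-! ### A knock-out tournament for the second anchor -/

section Candidate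

variable {n : ℕ} {K : Set (Fin n → Bool)} {b : Fin n}

/-- The number of `false` balls in a list minus the number of `true` balls. -/
def excess (c : Fin n → Bool) (l : List (Fin n)) : ℤ :=
  (l.map fun p => if c p = true then (-1 : ℤ) else 1).sum

theorem excess_cons (c : Fin n → Bool) (p : Fin n) (l : List (Fin n)) :
    excess c (p :: l) = (if c p = true then (-1 : ℤ) else 1) + excess c l := by
  simp [excess]

theorem excess_emod_two (c : Fin n → Bool) (l : List (Fin n)) :
    excess c l % 2 = (l.length : ℤ) % 2 := by
  induction l with
  | nil => rfl
  | cons p l ih =>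
    rw [excess_cons, List.length_cons]
    push_cast
    split_ifs <;> omega

/-- The balls are queried in pairs together with a `true` ball `b`. If the answer is `b`, then at
most one ball of the pair is `false` and both are dropped. Otherwise the lower ball of the pair is
kept: it is `false` unless both are `true`. -/
theorem learnable_halve (hK : ∀ c ∈ K, c b = true) (l : List (Fin n)) (hl : l.Nodup)
    (hb : b ∉ l) (heven : Even l.length) :
    Learnable (fun L => ∃ l' : List (Fin n), l'.Nodup ∧ l' ⊆ l ∧ 2 * l'.length ≤ l.length ∧
      ∀ c ∈ L, excess c l ≤ 2 * excess c l') K (l.length / 2) := by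
  induction hs : l.length using Nat.strong_induction_on generalizing l K with
  | _ s ih =>
  match l, hl, hb, heven, hs with
  | [], _, _, _, _ => exact .done ⟨[], by simp, by simp, by simp, by simp [excess]⟩
  | [a], _, _, heven, _ => simp at heven
  | p :: q :: l, hl, hb, heven, hs =>
    simp only [List.length_cons] at hs heven
    simp only [List.nodup_cons, List.mem_cons, not_or] at hl hb
    obtain ⟨⟨hpq, hpl⟩, hql, hl⟩ := hl
    obtain ⟨hbp, hbq, hbl⟩ := hb
    have rest : ∀ K' ⊆ K, _ := fun K' hK' => ih l.length (by omega)
      (fun c hc => hK c (hK' hc)) l hl hbl (by simpa [Nat.even_add] using heven) rfl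
    have hdiv : s / 2 = l.length / 2 + 1 := by omega
    rw [hdiv]
    -- the answers `p` and `q`: the ball `u` known to be the lower one is kept
    have keep : ∀ u v : Fin n, (u = p ∧ v = q ∨ u = q ∧ v = p) → ∀ K' ⊆ K,
        (∀ c ∈ K', c u = true → c v = true) →
        Learnable (fun L => ∃ l' : List (Fin n), l'.Nodup ∧ l' ⊆ p :: q :: l ∧
          2 * l'.length ≤ s ∧ ∀ c ∈ L, excess c (p :: q :: l) ≤ 2 * excess c l') K'
          (l.length / 2) := by
      intro u v huv K' hK' h
      refine (rest K' hK').imp fun L hL hG => ?_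
      obtain ⟨l', h1, h2, h3, h4⟩ := hG
      refine ⟨u :: l', List.nodup_cons.2 ⟨fun hu => ?_, h1⟩, ?_, ?_, fun c hc => ?_⟩
      · rcases huv with ⟨rfl, rfl⟩ | ⟨rfl, rfl⟩
        · exact hpl (h2 hu)
        · exact hql (h2 hu)
      · refine List.cons_subset.2 ⟨?_, fun w hw => by simp [h2 hw]⟩
        rcases huv with ⟨rfl, rfl⟩ | ⟨rfl, rfl⟩ <;> simp
      · rw [List.length_cons]; omega
      · have e := h4 c hc
        have e' := h c (hL hc)
        rw [excess_cons, excess_cons, excess_cons]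
        rcases huv with ⟨rfl, rfl⟩ | ⟨rfl, rfl⟩ <;> split_ifs <;>
          first | omega | (exfalso; tauto)
    refine Learnable.ask_triple hbp hbq hpq (fun K' hK' h => ?_) (fun K' hK' h => ?_)
      (fun K' hK' h => ?_)
    · refine (rest K' hK').imp fun L hL hG => ?_
      obtain ⟨l', h1, h2, h3, h4⟩ := hG
      refine ⟨l', h1, fun w hw => by simp [h2 hw], by omega, fun c hc => ?_⟩
      have e := h4 c hc
      have e' := h c (hL hc)
      rw [hK c (hK' (hL hc))] at e'
      rw [excess_cons, excess_cons]
      rcases e' with e' | e' <;> simp only [e', if_true] <;> split_ifs <;> omega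
    · refine keep q p (Or.inr ⟨rfl, rfl⟩) K' hK' fun c hc hq => ?_
      have e := h c hc
      rw [hK c (hK' hc), hq] at e
      rcases e with e | e <;> exact e.symm
    · refine keep p q (Or.inl ⟨rfl, rfl⟩) K' hK' fun c hc hp => ?_
      have e := h c hc
      rw [hK c (hK' hc), hp] at e
      rcases e with e | e <;> exact e.symm

/-- Repeated halving leaves a ball that is `false` whenever most balls of the list are. An unpaired
ball is kept exactly if the number of the other balls kept is even, so that a positive excess stays
positive. -/
theorem learnable_candidate (hK : ∀ c ∈ K, c b = true) (l : List (Fin n)) (hl : l.Nodup)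
    (hb : b ∉ l) :
    Learnable (fun L => (∀ c ∈ L, excess c l ≤ 0) ∨
      ∃ x ∈ l, ∀ c ∈ L, 0 < excess c l → c x = false) K l.length := by
  induction hs : l.length using Nat.strong_induction_on generalizing l K with
  | _ s ih =>
  have next : ∀ l' : List (Fin n), l'.Nodup → l' ⊆ l → l'.length < s → ∀ K' ⊆ K,
      (∀ c ∈ K', 0 < excess c l → 0 < excess c l') →
      Learnable (fun L => (∀ c ∈ L, excess c l ≤ 0) ∨
        ∃ x ∈ l, ∀ c ∈ L, 0 < excess c l → c x = false) K' l'.length := by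
    intro l' h1 h2 h3 K' hK' h4
    refine (ih l'.length h3 (fun c hc => hK c (hK' hc)) l' h1 (fun h => hb (h2 h)) rfl).imp
      fun L hL h => ?_
    rcases h with h | ⟨x, hx, h⟩
    · exact Or.inl fun c hc => not_lt.1 fun h' => not_lt.2 (h c hc) (h4 c (hL hc) h')
    · exact Or.inr ⟨x, h2 hx, fun c hc h' => h c hc (h4 c (hL hc) h')⟩
  rcases Nat.even_or_odd s with hev | hodd
  · rcases Nat.eq_zero_or_pos s with h0 | hpos
    · obtain rfl := List.length_eq_zero_iff.1 (hs.trans h0)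
      exact .done (Or.inl fun c _ => by simp [excess])
    refine ((learnable_halve hK l hl hb (hs ▸ hev)).bind (k' := s / 2) fun K' hK' h => ?_).mono_cost
      (by omega)
    obtain ⟨l', h1, h2, h3, h4⟩ := h
    exact (next l' h1 h2 (by omega) K' hK' fun c hc h => by have := h4 c hc; omega).mono_cost
      (by omega)
  · match l, hl, hb, hs, next with
    | [], _, _, hs, _ => simp [← hs] at hodd
    | r :: l, hl, hb, hs, next =>
      rw [List.length_cons] at hs
      rw [List.nodup_cons] at hl
      simp only [List.mem_cons, not_or] at hb
      have hlev : Even l.length := by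
        rw [← hs] at hodd
        by_contra h
        exact (Nat.not_even_iff_odd.2 hodd) (Nat.even_add_one.2 h)
      rcases Nat.eq_zero_or_pos l.length with h0 | hpos
      · obtain rfl := List.length_eq_zero_iff.1 h0
        refine .done (Or.inr ⟨r, by simp, fun c _ h => ?_⟩)
        by_contra hne
        rw [Bool.not_eq_false] at hne
        simp [excess, hne] at h
      refine ((learnable_halve hK l hl.2 hb.2 hlev).bind (k' := s / 2 + 1) fun K' hK' h =>
        ?_).mono_cost (by obtain ⟨j, hj⟩ := hodd; omega)
      obtain ⟨l', h1, h2, h3, h4⟩ := h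
      rcases Nat.even_or_odd l'.length with hev' | hodd'
      · refine (next (r :: l') (List.nodup_cons.2 ⟨fun h => hl.1 (h2 h), h1⟩)
          (List.cons_subset_cons _ h2) (by rw [List.length_cons]; omega) K' hK'
          fun c hc h => ?_).mono_cost (by rw [List.length_cons]; omega)
        have e1 := h4 c hc
        have e2 := excess_emod_two c l'
        obtain ⟨j, hj⟩ := hev'
        rw [excess_cons] at h ⊢
        split_ifs at h ⊢ <;> omega
      · refine (next l' h1 (fun w hw => by simp [h2 hw]) (by omega) K' hK'
          fun c hc h => ?_).mono_cost (by omega)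
        have e1 := h4 c hc
        have e2 := excess_emod_two c l'
        obtain ⟨j, hj⟩ := hodd'
        rw [excess_cons] at h
        split_ifs at h <;> omega

end Candidate

/-! ### The search -/

section Search

variable {n : ℕ} {K L : Set (Fin n → Bool)} {c : Fin n → Bool} {b x y : Fin n}

theorem isNonMinorityBall_univ :
    IsNonMinorityBall c Finset.univ y ↔ n ≤ 2 * (Finset.univ.filter (c · = c y)).card := by
  simp [IsNonMinorityBall]

theorem isNonMinorityBall_of_subset {S : Finset (Fin n)} (hS : n ≤ 2 * S.card)
    (h : ∀ q ∈ S, c q = c y) : IsNonMinorityBall c Finset.univ y := by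
  refine isNonMinorityBall_univ.2 (hS.trans (Nat.mul_le_mul_left 2 (Finset.card_le_card ?_)))
  exact fun q hq => Finset.mem_filter.2 ⟨Finset.mem_univ _, h q hq⟩

theorem IsNonMinorityBall.congr (h : IsNonMinorityBall c Finset.univ b) (hy : c y = c b) :
    IsNonMinorityBall c Finset.univ y := by
  rw [isNonMinorityBall_univ] at h ⊢
  rwa [hy]

theorem isNonMinorityBall_or (h : c b ≠ c x) :
    IsNonMinorityBall c Finset.univ b ∨ IsNonMinorityBall c Finset.univ x := by
  rw [isNonMinorityBall_univ, isNonMinorityBall_univ]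
  have h1 := Finset.card_filter_add_card_filter_not (s := Finset.univ) (c · = c b)
  have h2 : (Finset.univ.filter fun q => ¬ c q = c b) = Finset.univ.filter (c · = c x) := by
    refine Finset.filter_congr fun q _ => ?_
    cases h3 : c q <;> cases h4 : c b <;> cases h5 : c x <;> simp_all
  rw [h2, Finset.card_univ, Fintype.card_fin] at h1
  omega

/-- Linearly many queries yield a pair of balls one of which is non-minority: if `x` has the colour
of `b`, then `b` is non-minority, and if not, this is trivially so. -/
theorem learnable_pair (hn : 2 ≤ n) (b : Fin n) :
    Learnable (fun L => ∃ x, x ≠ b ∧ ∀ c ∈ L, c x = true → IsNonMinorityBall c Finset.univ b)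
      {c | c b = true} n := by
  have hlen : (Finset.univ.erase b).toList.length = n - 1 := by
    rw [Finset.length_toList, Finset.card_erase_of_mem (Finset.mem_univ b), Finset.card_univ,
      Fintype.card_fin]
  have key : ∀ c : Fin n → Bool, c b = true → excess c (Finset.univ.erase b).toList ≤ 0 →
      IsNonMinorityBall c Finset.univ b := by
    intro c hc h
    have h1 : excess c (Finset.univ.erase b).toList
        = ∑ p ∈ Finset.univ.erase b, if c p = true then (-1 : ℤ) else 1 := by
      rw [excess, Finset.sum_map_toList]
    have h2 := Finset.add_sum_erase Finset.univ (fun p => if c p = true then (-1 : ℤ) else 1)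
      (Finset.mem_univ b)
    have h3 := Finset.card_filter_add_card_filter_not (s := Finset.univ) (c · = true)
    have h4 : ∑ p : Fin n, (if c p = true then (-1 : ℤ) else 1)
        = -((Finset.univ.filter (c · = true)).card : ℤ)
          + ((Finset.univ.filter (¬ c · = true)).card : ℤ) := by
      rw [Finset.sum_ite, Finset.sum_const, Finset.sum_const]; simp
    rw [isNonMinorityBall_univ, hc]
    rw [Finset.card_univ, Fintype.card_fin] at h3
    simp only [hc, if_true] at h2
    omega
  refine ((learnable_candidate (fun c hc => hc) (Finset.univ.erase b).toList
    (Finset.nodup_toList _) (by simp)).imp fun L hL h => ?_).mono_cost (by omega)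
  rcases h with h | ⟨x, hx, h⟩
  · have : Nontrivial (Fin n) := Fin.nontrivial_iff_two_le.2 hn
    obtain ⟨x, hx⟩ := exists_ne b
    exact ⟨x, hx, fun c hc _ => key c (hL hc) (h c hc)⟩
  · refine ⟨x, by simpa using hx, fun c hc hcx => key c (hL hc) (not_lt.1 fun h' => ?_)⟩
    rw [h c hc h'] at hcx
    exact absurd hcx (by simp)

/-- If `b`, `x` and the colour of one of two opposite balls determine everything, then one of these
four balls is non-minority in both remaining cases. -/
theorem exists_isNonMinorityBall_of_decidedBy {m p : Fin n} (hA : Anchored K b x)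
    (hmp : Opp K m p) (h : ∀ q, DecidedBy K m q) :
    ∃ y, (y = b ∨ y = x ∨ y = m ∨ y = p) ∧ ∀ c ∈ K, IsNonMinorityBall c Finset.univ y := by
  have hbx : ∀ v : Bool, (∀ c ∈ K, c m = v → IsNonMinorityBall c Finset.univ b) ∨
      (∀ c ∈ K, c m = v → IsNonMinorityBall c Finset.univ x) := by
    intro v
    by_cases hv : ∃ c ∈ K, c m = v
    · obtain ⟨c, hc, hcv⟩ := hv
      have huniq : ∀ c' ∈ K, c' m = v → c' = c := fun c' hc' hv' =>
        funext fun q => h q c' hc' c hc (hv'.trans hcv.symm)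
      have hne : c b ≠ c x := by rw [(hA c hc).1, (hA c hc).2]; simp
      exact (isNonMinorityBall_or hne).imp (fun h c' hc' hv' => huniq c' hc' hv' ▸ h)
        (fun h c' hc' hv' => huniq c' hc' hv' ▸ h)
    · exact Or.inl fun c hc hcv => absurd ⟨c, hc, hcv⟩ hv
  rcases hbx true with ht | ht <;> rcases hbx false with hf | hf
  · refine ⟨b, by simp, fun c hc => ?_⟩
    cases hm : c m
    · exact hf c hc hm
    · exact ht c hc hm
  · refine ⟨m, by simp, fun c hc => ?_⟩
    cases hm : c m
    · exact (hf c hc hm).congr (by rw [hm, (hA c hc).2])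
    · exact (ht c hc hm).congr (by rw [hm, (hA c hc).1])
  · refine ⟨p, by simp, fun c hc => ?_⟩
    have hne := hmp c hc
    cases hm : c m
    · refine (hf c hc hm).congr ?_
      rw [hm] at hne
      rw [(hA c hc).1]; cases hp : c p <;> simp_all
    · refine (ht c hc hm).congr ?_
      rw [hm] at hne
      rw [(hA c hc).2]; cases hp : c p <;> simp_all
  · refine ⟨x, by simp, fun c hc => ?_⟩
    cases hm : c m
    · exact hf c hc hm
    · exact ht c hc hm

open scoped Classical in
/-- Linearly many queries lead to a non-minority ball, the colour of one ball `b` being called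
`true`. -/
theorem learnable_isNonMinorityBall (hn : 2 ≤ n) (b : Fin n) :
    Learnable (fun L => ∃ y, ∀ c ∈ L, IsNonMinorityBall c Finset.univ y) {c | c b = true}
      (802 * n) := by
  refine ((learnable_pair hn b).bind (k' := n + 800 * n) fun K hK h => ?_).mono_cost (by omega)
  obtain ⟨x, hxb, hx⟩ := h
  -- what the queries `{b, x, q}` tell; of the middle balls, only that they agree with `b` and `x`
  -- if these two agree
  have hcl : Learnable (fun L => (∀ q ∈ (Finset.univ \ {b, x} : Finset (Fin n)),
      (∀ c ∈ L, c x = false → c q = true) ∨ (∀ c ∈ L, c x = false → c q = false) ∨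
      (∀ c ∈ L, c x = true → c q = true)) ∨ False) K
      (1 * (Finset.univ \ {b, x} : Finset (Fin n)).card) := by
    refine Learnable.forall_or (G := fun q L => (∀ c ∈ L, c x = false → c q = true) ∨
      (∀ c ∈ L, c x = false → c q = false) ∨ (∀ c ∈ L, c x = true → c q = true))
      (fun q _ _ hL h => ?_) _ fun q hq K' hK' => ?_
    · rcases h with h | h | h
      · exact Or.inl fun c hc => h c (hL hc)
      · exact Or.inr (Or.inl fun c hc => h c (hL hc))
      · exact Or.inr (Or.inr fun c hc => h c (hL hc))
    · simp only [Finset.mem_sdiff, Finset.mem_univ, true_and, Finset.mem_insert,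
        Finset.mem_singleton, not_or] at hq
      refine Learnable.ask_triple hxb.symm (Ne.symm hq.1) (Ne.symm hq.2) (fun L hL h => ?_)
        (fun L hL h => ?_) (fun L hL h => ?_)
      · refine .done (Or.inl (Or.inl fun c hc hcx => ?_))
        have e := h c hc
        rw [hcx, show c b = true from hK (hK' (hL hc))] at e
        simpa using e
      · refine .done (Or.inl (Or.inr (Or.inl fun c hc hcx => ?_)))
        have e := h c hc
        rw [hcx, show c b = true from hK (hK' (hL hc))] at e
        simpa using e
      · refine .done (Or.inl (Or.inr (Or.inr fun c hc hcx => ?_)))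
        have e := h c hc
        rw [hcx, show c b = true from hK (hK' (hL hc))] at e
        rcases e with e | e <;> exact e.symm
  have hcard : 1 * (Finset.univ \ {b, x} : Finset (Fin n)).card ≤ n := by
    rw [one_mul]; exact (Finset.card_le_univ _).trans (by simp)
  refine (hcl.mono_cost hcard).bind fun M hM h => ?_
  rw [or_false] at h
  have hb : ∀ c ∈ M, c b = true := fun c hc => hK (hM hc)
  have hxM : ∀ c ∈ M, c x = true → IsNonMinorityBall c Finset.univ b :=
    fun c hc => hx c (hM hc)
  set A : Set (Fin n → Bool) := {c | c x = false} with hA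
  by_cases hne : ∃ c ∈ M, c x = false
  swap
  · refine .done ⟨b, fun c hc => hxM c hc ?_⟩
    cases hcx : c x
    · exact absurd ⟨c, hc, hcx⟩ hne
    · rfl
  obtain ⟨c₀, hc₀, hc₀x⟩ := hne
  set O := Finset.univ.filter (fun q => ∀ c ∈ M, c x = false → c q = true) with hO
  set Z := Finset.univ.filter (fun q => ∀ c ∈ M, c x = false → c q = false) with hZ
  have hOmem : ∀ q ∈ O, ∀ c ∈ M, c x = false → c q = true := fun q hq => (Finset.mem_filter.1 hq).2
  have hZmem : ∀ q ∈ Z, ∀ c ∈ M, c x = false → c q = false :=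
    fun q hq => (Finset.mem_filter.1 hq).2
  have hOZ : Disjoint O Z := Finset.disjoint_left.2 fun q hq hq' => by
    have e := hOmem q hq c₀ hc₀ hc₀x
    rw [hZmem q hq' c₀ hc₀ hc₀x] at e
    exact absurd e (by simp)
  by_cases hOn : n ≤ 2 * O.card
  · refine .done ⟨b, fun c hc => ?_⟩
    cases hcx : c x
    · exact isNonMinorityBall_of_subset hOn fun q hq => (hOmem q hq c hc hcx).trans (hb c hc).symm
    · exact hxM c hc hcx
  by_cases hZn : n ≤ 2 * Z.card
  · refine .done ⟨x, fun c hc => ?_⟩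
    cases hcx : c x
    · exact isNonMinorityBall_of_subset hZn fun q hq => (hZmem q hq c hc hcx).trans hcx.symm
    · exact (hxM c hc hcx).congr (hcx.trans (hb c hc).symm)
  set P := Finset.univ \ (O ∪ Z) with hP
  have hPcard : P.card + (O.card + Z.card) = n := by
    rw [← Finset.card_union_of_disjoint hOZ, hP,
      Finset.card_sdiff_add_card_eq_card (Finset.subset_univ _), Finset.card_univ, Fintype.card_fin]
  have hbO : b ∈ O := Finset.mem_filter.2 ⟨Finset.mem_univ _, fun c hc _ => hb c hc⟩
  have hxZ : x ∈ Z := Finset.mem_filter.2 ⟨Finset.mem_univ _, fun c _ hcx => hcx⟩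
  have hbP : b ∉ P := fun h => (Finset.mem_sdiff.1 h).2 (Finset.mem_union_left _ hbO)
  have hxP : x ∉ P := fun h => (Finset.mem_sdiff.1 h).2 (Finset.mem_union_right _ hxZ)
  have hmid : ∀ q ∈ P, ∀ c ∈ M, c x = true → c q = true := by
    intro q hq
    have hqn := (Finset.mem_sdiff.1 hq).2
    rw [Finset.mem_union, not_or] at hqn
    have hqbx : q ∈ (Finset.univ \ {b, x} : Finset (Fin n)) := by
      refine Finset.mem_sdiff.2 ⟨Finset.mem_univ _, fun h => ?_⟩
      rcases Finset.mem_insert.1 h with rfl | h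
      · exact hbP hq
      · rw [Finset.mem_singleton.1 h] at hq; exact hxP hq
    rcases h q hqbx with h | h | h
    · exact absurd (Finset.mem_filter.2 ⟨Finset.mem_univ _, h⟩) hqn.1
    · exact absurd (Finset.mem_filter.2 ⟨Finset.mem_univ _, h⟩) hqn.2
    · exact h
  -- an output among `b`, `x` and the middle balls is right if `b` and `x` agree
  have hagree : ∀ y, (y = b ∨ y = x ∨ y ∈ P) → ∀ c ∈ M, c x = true →
      IsNonMinorityBall c Finset.univ y := by
    intro y hy c hc hcx
    refine (hxM c hc hcx).congr ?_
    rw [hb c hc]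
    rcases hy with rfl | rfl | hy
    · exact hb c hc
    · exact hcx
    · exact hmid y hy c hc hcx
  have hanch : Anchored (M ∩ A) b x := fun c hc => ⟨hb c hc.1, hc.2⟩
  -- the rank for which `k` false balls in `P`, or `|P| + 1 - k` true ones, make up half of all
  have hk1 : 1 ≤ (n + 1) / 2 - Z.card := by omega
  have hkP : (n + 1) / 2 - Z.card ≤ P.card := by omega
  refine ((learnable_selected hanch hbP hxP hk1 hkP).of_inter.imp fun L hL hG => ?_).mono_cost
    (by omega)
  rcases hG with ⟨y, hy, h1, h2⟩ | ⟨m, hm, p, hp, hmp, hdec⟩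
  · refine ⟨y, fun c hc => ?_⟩
    cases hcx : c x
    swap
    · exact hagree y (Or.inr (Or.inr hy)) c (hL hc) hcx
    have hcA : c ∈ L ∩ A := ⟨hc, hcx⟩
    have hPO : Disjoint P O := Finset.sdiff_disjoint.mono_right Finset.subset_union_left
    have hPZ : Disjoint P Z := Finset.sdiff_disjoint.mono_right Finset.subset_union_right
    cases hcy : c y
    · refine isNonMinorityBall_of_subset (S := P.filter (Le (L ∩ A) · y) ∪ Z) ?_ fun q hq => ?_
      · rw [Finset.card_union_of_disjoint (hPZ.mono_left (Finset.filter_subset _ _))]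
        omega
      · rw [hcy]
        rcases Finset.mem_union.1 hq with hq | hq
        · exact (Finset.mem_filter.1 hq).2.eq_false hcA hcy
        · exact hZmem q hq c (hL hc) hcx
    · refine isNonMinorityBall_of_subset (S := P.filter (Le (L ∩ A) y ·) ∪ O) ?_ fun q hq => ?_
      · rw [Finset.card_union_of_disjoint (hPO.mono_left (Finset.filter_subset _ _))]
        omega
      · rw [hcy]
        rcases Finset.mem_union.1 hq with hq | hq
        · exact (Finset.mem_filter.1 hq).2 c hcA hcy
        · exact hOmem q hq c (hL hc) hcx
  · have hall : ∀ q, DecidedBy (L ∩ A) m q := by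
      intro q
      by_cases hqO : q ∈ O
      · exact (const_of_forall true fun c hc => hOmem q hqO c (hL hc.1) hc.2).decidedBy _
      by_cases hqZ : q ∈ Z
      · exact (const_of_forall false fun c hc => hZmem q hqZ c (hL hc.1) hc.2).decidedBy _
      exact hdec q (Finset.mem_sdiff.2 ⟨Finset.mem_univ _, by simp [hqO, hqZ]⟩)
    obtain ⟨y, hy, hyN⟩ := exists_isNonMinorityBall_of_decidedBy
      (hanch.mono (Set.inter_subset_inter_left A hL)) hmp hall
    refine ⟨y, fun c hc => ?_⟩
    cases hcx : c x
    · exact hyN c ⟨hc, hcx⟩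
    · refine hagree y ?_ c (hL hc) hcx
      rcases hy with rfl | rfl | rfl | rfl <;> simp [hm, hp]

theorem Learnable.exists_strategy {k : ℕ}
    (h : Learnable (fun L => ∃ y, ∀ c ∈ L, IsNonMinorityBall c Finset.univ y) K k) :
    ∃ s : Strategy 3 n, ∀ c ∈ K, s.FindsWithin c k := by
  induction h with
  | done h =>
    obtain ⟨y, hy⟩ := h
    exact ⟨.output y, fun c hc => by simpa only [Strategy.FindsWithin] using hy c hc⟩
  | ask Q hQ _ ih =>
    choose next hnext using ih
    refine ⟨.query Q hQ next, fun c hc => ?_⟩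
    simp only [Strategy.FindsWithin]
    exact fun a ha => hnext a c ⟨hc, ha⟩

theorem isMajorityBall_not {Q : Finset (Fin n)} :
    IsMajorityBall (fun i => !c i) Q y ↔ IsMajorityBall c Q y := by
  simp [IsMajorityBall]

theorem isValidAnswer_not {Q : Finset (Fin n)} {a : Option (Fin n)} :
    IsValidAnswer (fun i => !c i) Q a ↔ IsValidAnswer c Q a := by
  cases a <;> simp [IsValidAnswer, isMajorityBall_not]

/-- Answers and non-minority balls stay the same if the two colours are exchanged. -/
theorem Strategy.findsWithin_not {s : Strategy 3 n} {k : ℕ} :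
    s.FindsWithin (fun i => !c i) k ↔ s.FindsWithin c k := by
  induction s generalizing k with
  | output b => simp [Strategy.FindsWithin, IsNonMinorityBall]
  | query Q hQ next ih =>
    cases k with
    | zero => simp [Strategy.FindsWithin]
    | succ k => simp [Strategy.FindsWithin, isValidAnswer_not, ih]

theorem adaptivelySolvable_three (hn : 1 ≤ n) : AdaptivelySolvable 3 n (802 * n) := by
  have b : Fin n := ⟨0, hn⟩
  suffices h : Learnable (fun L => ∃ y, ∀ c ∈ L, IsNonMinorityBall c Finset.univ y)
      {c | c b = true} (802 * n) by
    obtain ⟨s, hs⟩ := h.exists_strategy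
    refine ⟨s, fun c => ?_⟩
    cases hc : c b
    · exact Strategy.findsWithin_not.1 (hs _ (by simp [hc]))
    · exact hs c hc
  rcases Nat.lt_or_ge n 2 with h | h
  · refine .done ⟨b, fun c _ => isNonMinorityBall_of_subset (S := {b}) ?_ ?_⟩
    · rw [Finset.card_singleton]; omega
    · simp
  · exact learnable_isNonMinorityBall h b

end Search
end BallSearch

theorem theorem2 :
    ∃ C : ℕ, 0 < C ∧ ∀ n : ℕ, 1 ≤ n → BallSearch.A 3 n ≤ (C : ℕ∞) * (n : ℕ∞) := by
  refine ⟨802, by norm_num, fun n hn => ?_⟩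
  have h := BallSearch.adaptivelySolvable_three hn
  calc BallSearch.A 3 n ≤ ((802 * n : ℕ) : ℕ∞) := iInf₂_le _ h
    _ = ((802 : ℕ) : ℕ∞) * (n : ℕ∞) := by push_cast; rfl
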